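/- A \emph{skew shape} $\sigma/\rho$ is the set-theoretic difference of the Young diagrams of two partitions with $\rho\subseteq\sigma$; two skew shapes are identified if one is a translate of the other. It is \emph{connected} if any two of its squares are joined by a sequence of squares of the shape in which consecutive squares share an edge. For a nonempty connected skew shape $\alpha$ let $\operatorname{row}(\alpha)$, $\operatorname{col}(\alpha)$ and $\operatorname{area}(\alpha)$ be its numbers of nonempty rows, nonempty columns and squares. A \emph{diagonal} of $\alpha$ is the set of its squares in row $i$ and column $j$ with $i-j=k$, for a fixed integer $k$. Let $\mathrm{CS}^{\le n}$ be the set of nonempty connected skew shapes (up to translation) in which every diagonal has at most $n$ squares. The $q$-Lommel polynomials $R_{m,\nu}(z;q)$ are the Laurent polynomials in $z$ defined by $R_{-1,\nu}(z;q)=0$, $R_{0,\nu}(z;q)=1$ and $$R_{m+1,\nu}(z;q)=\bigl(z+z^{-1}(1-q^{\nu+m})\bigr)R_{m,\nu}(z;q)-R_{m-1,\nu}(z;q)\qquad(m\ge 0).$$ Regard $z$, $q$ and $q^\nu$ as independent variables, with $(q^{-1})^{\nu+k}=(q^{\nu})^{-1}q^{-k}$. \textbf{Theorem.} For every integer $m\ge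 0$, $$\sum_{\alpha\in \mathrm{CS}^{\le m+1}} (q^\nu z^2)^{\operatorname{col}(\alpha)} (q^\nu)^{\operatorname{row}(\alpha)} q^{\operatorname{area}(\alpha)} = -q^\nu z\,\frac{R_{m,\nu+2}(z;q^{-1})}{R_{m+1,\nu+1}(z;q^{-1})}.$$ Here the sum on the left converges in the ring of formal power series $\mathbb{Z}[[z,q,q^\nu]]$ (with coefficientwise convergence), $R_{m+1,\nu+1}(z;q^{-1})\neq 0$, and the identity holds in the field of fractions of that ring. -/

import Mathlib

open scoped MvPowerSeries.WithPiTopology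

/-- Two squares, given as `(row, column)`, share an edge. -/
def ShareEdge (u v : ℕ × ℕ) : Prop :=
  (u.1 = v.1 ∧ (u.2 + 1 = v.2 ∨ v.2 + 1 = u.2)) ∨
    (u.2 = v.2 ∧ (u.1 + 1 = v.1 ∨ v.1 + 1 = u.1))

/-- A placed nonempty connected skew shape: a nonempty set of squares of the form `σ / ρ` with
`ρ ⊆ σ` Young diagrams, in which any two squares are joined by a sequence of squares of the shape,
consecutive ones sharing an edge. -/
structure PlacedConnectedSkewShape where
  cells : Finset (ℕ × ℕ)
  isSkew : ∃ σ ρ : YoungDiagram, ρ ≤ σ ∧ cells = σ.cells \ ρ.cells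
  nonempty : cells.Nonempty
  connected : ∀ u ∈ cells, ∀ v ∈ cells,
    Relation.ReflTransGen (fun a b => a ∈ cells ∧ b ∈ cells ∧ ShareEdge a b) u v

namespace PlacedConnectedSkewShape

/-- `β` is obtained from `α` by translation by an integer vector `(a, b)`. -/
def IsTranslate (α β : PlacedConnectedSkewShape) : Prop :=
  ∃ a b : ℤ, β.cells.image (fun c : ℕ × ℕ => ((c.1 : ℤ), (c.2 : ℤ))) =
    α.cells.image (fun c : ℕ × ℕ => ((c.1 : ℤ) + a, (c.2 : ℤ) + b))

/-- The number of nonempty rows. -/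
def row (α : PlacedConnectedSkewShape) : ℕ := (α.cells.image Prod.fst).card

/-- The number of nonempty columns. -/
def col (α : PlacedConnectedSkewShape) : ℕ := (α.cells.image Prod.snd).card

/-- The number of squares. -/
def area (α : PlacedConnectedSkewShape) : ℕ := α.cells.card

/-- The number of squares `(i, j)` on the diagonal `i - j = k`. -/
def diagLength (α : PlacedConnectedSkewShape) (k : ℤ) : ℕ :=
  (α.cells.filter (fun c : ℕ × ℕ => (c.1 : ℤ) - (c.2 : ℤ) = k)).card

/-- Every diagonal has at most `m` squares. -/
def DiagLE (m : ℕ) (α : PlacedConnectedSkewShape) : Prop := ∀ k : ℤ, α.diagLength k ≤ m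

theorem isTranslate_equivalence : Equivalence IsTranslate := by
  have key : ∀ (S T : Finset (ℕ × ℕ)) (a b : ℤ),
      T.image (fun c : ℕ × ℕ => ((c.1 : ℤ), (c.2 : ℤ))) =
        S.image (fun c : ℕ × ℕ => ((c.1 : ℤ) + a, (c.2 : ℤ) + b)) ↔
      ∀ x y : ℤ, (∃ c ∈ T, (c.1 : ℤ) = x ∧ (c.2 : ℤ) = y) ↔
        ∃ c ∈ S, (c.1 : ℤ) = x - a ∧ (c.2 : ℤ) = y - b := by
    intro S T a b
    simp only [Finset.ext_iff, Finset.mem_image, Prod.forall, Prod.mk.injEq,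
      eq_sub_iff_add_eq]
  refine ⟨fun α => ⟨0, 0, by simp⟩, ?_, ?_⟩
  · rintro α β ⟨a, b, h⟩
    rw [key] at h
    refine ⟨-a, -b, (key _ _ _ _).2 fun x y => ?_⟩
    have := h (x + a) (y + b)
    simp only [add_sub_cancel_right] at this
    simpa only [sub_neg_eq_add] using this.symm
  · rintro α β γ ⟨a, b, h⟩ ⟨a', b', h'⟩
    rw [key] at h h'
    refine ⟨a' + a, b' + b, (key _ _ _ _).2 fun x y => ?_⟩
    rw [h' x y, h (x - a') (y - b'), sub_sub, sub_sub]

/-- Skew shapes are identified when one is obtained from the other by translation. -/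
instance setoid : Setoid PlacedConnectedSkewShape := ⟨IsTranslate, isTranslate_equivalence⟩

theorem row_congr (α β : PlacedConnectedSkewShape) (h : IsTranslate α β) : α.row = β.row := by
  obtain ⟨a, b, h⟩ := h
  have e := congrArg (fun s : Finset (ℤ × ℤ) => (s.image Prod.fst).card) h
  simp only [Finset.image_image] at e
  have h1 : β.cells.image (Prod.fst ∘ fun c : ℕ × ℕ => ((c.1 : ℤ), (c.2 : ℤ))) =
      (β.cells.image Prod.fst).image (fun n : ℕ => (n : ℤ)) := by
    rw [Finset.image_image]; rfl
  have h2 : α.cells.image (Prod.fst ∘ fun c : ℕ × ℕ => ((c.1 : ℤ) + a, (c.2 : ℤ) + b)) =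
      (α.cells.image Prod.fst).image (fun n : ℕ => (n : ℤ) + a) := by
    rw [Finset.image_image]; rfl
  rw [h1, h2, Finset.card_image_of_injective _ Nat.cast_injective,
    Finset.card_image_of_injective _
      (fun x y hxy => Nat.cast_injective (add_right_cancel hxy))] at e
  exact e.symm

theorem col_congr (α β : PlacedConnectedSkewShape) (h : IsTranslate α β) : α.col = β.col := by
  obtain ⟨a, b, h⟩ := h
  have e := congrArg (fun s : Finset (ℤ × ℤ) => (s.image Prod.snd).card) h
  simp only [Finset.image_image] at e
  have h1 : β.cells.image (Prod.snd ∘ fun c : ℕ × ℕ => ((c.1 : ℤ), (c.2 : ℤ))) =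
      (β.cells.image Prod.snd).image (fun n : ℕ => (n : ℤ)) := by
    rw [Finset.image_image]; rfl
  have h2 : α.cells.image (Prod.snd ∘ fun c : ℕ × ℕ => ((c.1 : ℤ) + a, (c.2 : ℤ) + b)) =
      (α.cells.image Prod.snd).image (fun n : ℕ => (n : ℤ) + b) := by
    rw [Finset.image_image]; rfl
  rw [h1, h2, Finset.card_image_of_injective _ Nat.cast_injective,
    Finset.card_image_of_injective _
      (fun x y hxy => Nat.cast_injective (add_right_cancel hxy))] at e
  exact e.symm

theorem cast_injective :
    Function.Injective (fun c : ℕ × ℕ => ((c.1 : ℤ), (c.2 : ℤ))) := by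
  rintro ⟨x, y⟩ ⟨x', y'⟩ h
  simpa using h

theorem cast_add_injective (a b : ℤ) :
    Function.Injective (fun c : ℕ × ℕ => ((c.1 : ℤ) + a, (c.2 : ℤ) + b)) := by
  rintro ⟨x, y⟩ ⟨x', y'⟩ h
  simpa using h

theorem area_congr (α β : PlacedConnectedSkewShape) (h : IsTranslate α β) :
    α.area = β.area := by
  obtain ⟨a, b, h⟩ := h
  have e := congrArg Finset.card h
  rw [Finset.card_image_of_injective _ cast_injective,
    Finset.card_image_of_injective _ (cast_add_injective a b)] at e
  exact e.symm

theorem diagLE_of_isTranslate (m : ℕ) (α β : PlacedConnectedSkewShape) (h : IsTranslate α β)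
    (hα : α.DiagLE m) : β.DiagLE m := by
  obtain ⟨a, b, h⟩ := h
  intro k
  refine le_trans (le_of_eq ?_) (hα (k - a + b))
  have e := congrArg
    (fun s : Finset (ℤ × ℤ) => (s.filter (fun c : ℤ × ℤ => c.1 - c.2 = k)).card) h
  simp only [Finset.filter_image] at e
  rw [Finset.card_image_of_injective _ cast_injective,
    Finset.card_image_of_injective _ (cast_add_injective a b)] at e
  unfold diagLength
  rw [e]
  congr 1
  apply Finset.filter_congr
  intro c _
  constructor <;> intro hc <;> linarith

theorem diagLE_congr (m : ℕ) (α β : PlacedConnectedSkewShape) (h : IsTranslate α β) :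
    α.DiagLE m = β.DiagLE m :=
  propext ⟨diagLE_of_isTranslate m α β h,
    diagLE_of_isTranslate m β α (isTranslate_equivalence.symm h)⟩

end PlacedConnectedSkewShape

/-- The set of nonempty connected skew shapes, up to translation. -/
def ConnectedSkewShape : Type := Quotient PlacedConnectedSkewShape.setoid

namespace ConnectedSkewShape

/-- The number of nonempty rows. -/
def row : ConnectedSkewShape → ℕ :=
  Quotient.lift PlacedConnectedSkewShape.row PlacedConnectedSkewShape.row_congr

/-- The number of nonempty columns. -/
def col : ConnectedSkewShape → ℕ :=
  Quotient.lift PlacedConnectedSkewShape.col PlacedConnectedSkewShape.col_congr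

/-- The number of squares. -/
def area : ConnectedSkewShape → ℕ :=
  Quotient.lift PlacedConnectedSkewShape.area PlacedConnectedSkewShape.area_congr

/-- Every diagonal has at most `m` squares. -/
def DiagLE (m : ℕ) : ConnectedSkewShape → Prop :=
  Quotient.lift (PlacedConnectedSkewShape.DiagLE m) (PlacedConnectedSkewShape.diagLE_congr m)

end ConnectedSkewShape

/-- The connected skew shapes in which every diagonal has at most `m` squares. -/
abbrev BoundedSkewShape (m : ℕ) : Type := {α : ConnectedSkewShape // α.DiagLE m}

/-- The `q`-Lommel polynomial `R_{m,ν}(z;p)` with base `p`, where `t` stands for `p ^ ν`. The value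
at `m = 1` is the recurrence `R_{m+1} = (z + z⁻¹ (1 - p^{ν+m})) R_m - R_{m-1}` at `m = 0`
with `R_{-1} = 0`. -/
def qLommel {K : Type*} [Field K] (z p t : K) : ℕ → K
  | 0 => 1
  | 1 => z + z⁻¹ * (1 - t)
  | m + 2 => (z + z⁻¹ * (1 - t * p ^ (m + 1))) * qLommel z p t (m + 1) - qLommel z p t m

/-- Formal power series over `ℤ` in three independent variables `z`, `q` and `q ^ ν`. -/
abbrev PSeries : Type := MvPowerSeries (Fin 3) ℤ

instance PSeries.isDomain : IsDomain PSeries := NoZeroDivisors.to_isDomain _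

/-- The field of fractions of the ring of formal power series in `z`, `q`, `q ^ ν`. -/
abbrev PField : Type := FractionRing PSeries

/-- The variable `z`. -/
noncomputable def zVar : PSeries := MvPowerSeries.X 0

/-- The variable `q`. -/
noncomputable def qVar : PSeries := MvPowerSeries.X 1

/-- The variable `q ^ ν`. -/
noncomputable def qNu : PSeries := MvPowerSeries.X 2

/-- The term `(q^ν z²)^col (q^ν)^row q^area` of the generating function. -/
noncomputable def shapeWeight (α : ConnectedSkewShape) : PSeries :=
  (qNu * zVar ^ 2) ^ α.col * qNu ^ α.row * qVar ^ α.area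

/-- `R_{m,ν+k}(z;q⁻¹)`, with `(q⁻¹)^(ν+k) = (q^ν)⁻¹ q^(-k)`, as an element of the fraction field. -/
noncomputable def lommelR (m k : ℕ) : PField :=
  qLommel (algebraMap PSeries PField zVar) (algebraMap PSeries PField qVar)⁻¹
    ((algebraMap PSeries PField qNu)⁻¹ * (algebraMap PSeries PField qVar)⁻¹ ^ k) m

/-!
Read the diagonals of a connected skew shape from the upper right to the lower left. Each end of a
diagonal moves one step south or west to reach the next diagonal, so a shape is the same as a word
in these pairs of moves: the length of the diagonal grows by one, shrinks by one or stays (in two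
ways), it starts at `1`, remains between `1` and `n`, and the shape ends when it reaches `0`. The
moves also count the rows and the columns.

Let `F h` be the generating function of the words that start at length `h ≤ n`. Removing the first
letter gives `F h = q ^ h (q^ν F h + F (h + 1) + (q^ν z)² F (h - 1) + q^ν z² F h)`, with `F 0 = 1`
and `F (n + 1) = 0`. After division by `(-q^ν z) ^ h` this is the recurrence of the `q`-Lommel
polynomials with base `q⁻¹`, so `F h` is the combination of its two solutions with `ν + 1` and
`ν + 2`, and the vanishing at `n + 1` determines `F 1`. If the denominator were zero, then
`F (n + 1) = 0` and `F 0 ≠ 0` would make both solutions vanish there, but their Casoratian is `-1`.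
-/

/-- The two unit steps that an end of a diagonal can make when one passes to the next diagonal,
the diagonals being read from the upper right to the lower left. -/
inductive Direction
  | south
  | west
  deriving DecidableEq

namespace Direction

instance : Fintype Direction := ⟨{south, west}, by rintro (_ | _) <;> decide⟩

theorem sum_univ {M : Type*} [AddCommMonoid M] (f : Direction → M) :
    ∑ d, f d = f south + f west :=
  Finset.sum_pair (by decide)

/-- The displacement of a square, given as `(row, column)`, in the direction `d`. -/
def vec : Direction → ℤ × ℤ
  | south => (1, 0)
  | west => (0, -1)

end Direction

/-- The difference `i - j` that indexes the diagonal through the square `(i, j)`. -/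
def diagIndex (p : ℤ × ℤ) : ℤ := p.1 - p.2

theorem diagIndex_add_vec (p : ℤ × ℤ) (d : Direction) :
    diagIndex (p + d.vec) = diagIndex p + 1 := by
  cases d <;> simp only [diagIndex, Direction.vec, Prod.fst_add, Prod.snd_add] <;> ring

theorem add_vec_le {p q : ℤ × ℤ} (d : Direction) (hpq : p ≤ q) (h : diagIndex p < diagIndex q) :
    p + d.vec ≤ q := by
  cases d <;> simp only [diagIndex, Direction.vec, Prod.le_def, Prod.fst_add, Prod.snd_add] at * <;>
    omega

theorem le_add_vec {p q : ℤ × ℤ} (d : Direction) (hqp : q ≤ p) (h : diagIndex p < diagIndex q) :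
    q ≤ p + d.vec := by
  cases d <;> simp only [diagIndex, Direction.vec, Prod.le_def, Prod.fst_add, Prod.snd_add] at * <;>
    omega

/-- The run of `h` consecutive squares of one diagonal that starts at its upper left square `p`. -/
def diagonal (p : ℤ × ℤ) (h : ℕ) : Finset (ℤ × ℤ) :=
  (Finset.range h).image fun e : ℕ => p + ((e : ℤ), (e : ℤ))

/-- The last square of `diagonal p h`; for `h = 0` it is the square before `p`. -/
def lowerRight (p : ℤ × ℤ) (h : ℕ) : ℤ × ℤ := (p.1 + h - 1, p.2 + h - 1)

theorem diagIndex_lowerRight (p : ℤ × ℤ) (h : ℕ) : diagIndex (lowerRight p h) = diagIndex p := by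
  simp only [diagIndex, lowerRight]
  ring

theorem mem_diagonal {p q : ℤ × ℤ} {h : ℕ} :
    q ∈ diagonal p h ↔ diagIndex q = diagIndex p ∧ p ≤ q ∧ q ≤ lowerRight p h := by
  simp only [diagonal, lowerRight, diagIndex, Finset.mem_image, Finset.mem_range, Prod.ext_iff,
    Prod.fst_add, Prod.snd_add, Prod.le_def]
  constructor
  · rintro ⟨e, he, h₁, h₂⟩
    omega
  · intro hq
    exact ⟨(q.1 - p.1).toNat, by omega, by omega, by omega⟩

theorem card_diagonal (p : ℤ × ℤ) (h : ℕ) : (diagonal p h).card = h := by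
  rw [diagonal, Finset.card_image_of_injective, Finset.card_range]
  intro d e hde
  simpa using hde

theorem left_mem_diagonal {p : ℤ × ℤ} {h : ℕ} (hh : 1 ≤ h) : p ∈ diagonal p h :=
  mem_diagonal.2 ⟨rfl, le_rfl, by simp only [lowerRight, Prod.le_def]; omega⟩

theorem lowerRight_mem_diagonal {p : ℤ × ℤ} {h : ℕ} (hh : 1 ≤ h) :
    lowerRight p h ∈ diagonal p h :=
  mem_diagonal.2 ⟨diagIndex_lowerRight p h, by simp only [lowerRight, Prod.le_def]; omega, le_rfl⟩

theorem diagonal_zero (p : ℤ × ℤ) : diagonal p 0 = ∅ := rfl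

theorem diagonal_one (p : ℤ × ℤ) : diagonal p 1 = {p} := by
  simp [diagonal]

theorem image_add_diagonal (p v : ℤ × ℤ) (h : ℕ) :
    (diagonal p h).image (· + v) = diagonal (p + v) h := by
  simp only [diagonal, Finset.image_image, Function.comp_def, add_right_comm]

theorem image_fst_diagonal (p : ℤ × ℤ) (h : ℕ) :
    (diagonal p h).image Prod.fst = Finset.Ico p.1 (p.1 + h) := by
  ext i
  simp only [Finset.mem_image, Finset.mem_Ico, mem_diagonal, diagIndex, lowerRight, Prod.le_def]
  constructor
  · rintro ⟨q, hq, rfl⟩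
    omega
  · intro hi
    exact ⟨(i, p.2 + (i - p.1)), by dsimp only; omega, rfl⟩

theorem image_snd_diagonal (p : ℤ × ℤ) (h : ℕ) :
    (diagonal p h).image Prod.snd = Finset.Ico p.2 (p.2 + h) := by
  ext j
  simp only [Finset.mem_image, Finset.mem_Ico, mem_diagonal, diagIndex, lowerRight, Prod.le_def]
  constructor
  · rintro ⟨q, hq, rfl⟩
    omega
  · intro hj
    exact ⟨(p.1 + (j - p.2), j), by dsimp only; omega, rfl⟩

/-- The moves of the upper left and of the lower right end of a diagonal. -/
abbrev BoundaryStep : Type := Direction × Direction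

/-- The length of the diagonal that follows a diagonal of length `h`. The truncated subtraction is
only met for `h = 0`, which `IsBoundaryWord` excludes. -/
def nextLength (h : ℕ) : BoundaryStep → ℕ
  | (.south, .west) => h - 1
  | (.west, .south) => h + 1
  | (.south, .south) => h
  | (.west, .west) => h

theorem lowerRight_nextLength (p : ℤ × ℤ) {h : ℕ} (hh : 1 ≤ h) (s : BoundaryStep) :
    lowerRight (p + s.1.vec) (nextLength h s) = lowerRight p h + s.2.vec := by
  obtain ⟨_ | _, _ | _⟩ := s <;>
    simp only [lowerRight, nextLength, Direction.vec, Prod.ext_iff, Prod.fst_add, Prod.snd_add] <;>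
    omega

theorem diagonal_nextLength_injective {p : ℤ × ℤ} {h : ℕ} (hh : 1 ≤ h) :
    Function.Injective fun s : BoundaryStep => diagonal (p + s.1.vec) (nextLength h s) := by
  intro s s' heq
  have hlen : nextLength h s = nextLength h s' := by
    simpa only [card_diagonal] using congrArg Finset.card heq
  have hfirst (hpos : 1 ≤ nextLength h s) : s.1.vec.1 = s'.1.vec.1 := by
    have h₁ := mem_diagonal.1 (heq.subset (left_mem_diagonal hpos))
    have h₂ := mem_diagonal.1 (heq.superset (left_mem_diagonal (hlen ▸ hpos)))
    simpa using le_antisymm h₂.2.1.1 h₁.2.1.1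
  obtain ⟨_ | _, _ | _⟩ := s <;> obtain ⟨_ | _, _ | _⟩ := s' <;>
    simp only [nextLength, Direction.vec, Prod.mk.injEq, reduceCtorEq, and_true, true_and,
      and_self] at hlen hfirst ⊢ <;> omega

/-- Every diagonal has between `1` and `n` squares, the first one has `h` squares, and the word ends
when the diagonals become empty, that is, when the two boundary paths meet. -/
inductive IsBoundaryWord (n : ℕ) : ℕ → List BoundaryStep → Prop
  | nil : IsBoundaryWord n 0 []
  | cons {h : ℕ} {s : BoundaryStep} {w : List BoundaryStep} (one_le : 1 ≤ h) (le : h ≤ n)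
      (tail : IsBoundaryWord n (nextLength h s) w) : IsBoundaryWord n h (s :: w)

/-- The squares swept by the diagonals of a word, the first one being `diagonal p h`. -/
def wordCells : List BoundaryStep → ℤ × ℤ → ℕ → Finset (ℤ × ℤ)
  | [], _, _ => ∅
  | s :: w, p, h => diagonal p h ∪ wordCells w (p + s.1.vec) (nextLength h s)

/-- The number of rows of the shape of a word: the height of its upper boundary path. -/
def wordRows (w : List BoundaryStep) : ℕ := (w.map Prod.fst).count .south

/-- The number of columns of the shape of a word: the width of its lower boundary path. -/
def wordCols (w : List BoundaryStep) : ℕ := (w.map Prod.snd).count .west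

/-- The number of squares of the shape of a word with a first diagonal of `h` squares. -/
def wordArea : ℕ → List BoundaryStep → ℕ
  | _, [] => 0
  | h, s :: w => h + wordArea (nextLength h s) w

theorem wordRows_cons (s : BoundaryStep) (w : List BoundaryStep) :
    wordRows (s :: w) = wordRows w + if s.1 = .south then 1 else 0 := by
  simp only [wordRows, List.map_cons, List.count_cons, beq_iff_eq]

theorem wordCols_cons (s : BoundaryStep) (w : List BoundaryStep) :
    wordCols (s :: w) = wordCols w + if s.2 = .west then 1 else 0 := by
  simp only [wordCols, List.map_cons, List.count_cons, beq_iff_eq]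

theorem mem_wordCells_cons {s : BoundaryStep} {w : List BoundaryStep} {p q : ℤ × ℤ} {h : ℕ} :
    q ∈ wordCells (s :: w) p h ↔
      q ∈ diagonal p h ∨ q ∈ wordCells w (p + s.1.vec) (nextLength h s) :=
  Finset.mem_union

theorem diagIndex_le_of_mem_wordCells {w : List BoundaryStep} {p q : ℤ × ℤ} {h : ℕ}
    (hq : q ∈ wordCells w p h) : diagIndex p ≤ diagIndex q := by
  induction w generalizing p h with
  | nil => exact absurd hq (Finset.notMem_empty q)
  | cons s w ih =>
    rcases mem_wordCells_cons.1 hq with hq | hq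
    · exact (mem_diagonal.1 hq).1.ge
    · have := ih hq
      rw [diagIndex_add_vec] at this
      omega

theorem filter_diagIndex_lt_wordCells_cons (s : BoundaryStep) (w : List BoundaryStep) (p : ℤ × ℤ)
    (h : ℕ) : (wordCells (s :: w) p h).filter (diagIndex p < diagIndex ·) =
      wordCells w (p + s.1.vec) (nextLength h s) := by
  ext q
  have hdiag := fun hq : q ∈ diagonal p h => (mem_diagonal.1 hq).1
  have htail := fun hq => (diagIndex_add_vec p s.1).symm.trans_le
    (diagIndex_le_of_mem_wordCells (q := q) (w := w) (h := nextLength h s) hq)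
  rw [Finset.mem_filter, mem_wordCells_cons]
  grind

theorem filter_diagIndex_eq_wordCells_cons (s : BoundaryStep) (w : List BoundaryStep) (p : ℤ × ℤ)
    (h : ℕ) : (wordCells (s :: w) p h).filter (diagIndex · = diagIndex p) = diagonal p h := by
  ext q
  have hdiag := fun hq : q ∈ diagonal p h => (mem_diagonal.1 hq).1
  have htail := fun hq => (diagIndex_add_vec p s.1).symm.trans_le
    (diagIndex_le_of_mem_wordCells (q := q) (w := w) (h := nextLength h s) hq)
  rw [Finset.mem_filter, mem_wordCells_cons]
  grind

theorem image_add_wordCells (w : List BoundaryStep) (p v : ℤ × ℤ) (h : ℕ) :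
    (wordCells w p h).image (· + v) = wordCells w (p + v) h := by
  induction w generalizing p h with
  | nil => rfl
  | cons s w ih =>
    rw [wordCells, wordCells, Finset.image_union, image_add_diagonal, ih, add_right_comm]

theorem card_wordCells (w : List BoundaryStep) (p : ℤ × ℤ) (h : ℕ) :
    (wordCells w p h).card = wordArea h w := by
  induction w generalizing p h with
  | nil => rfl
  | cons s w ih =>
    have hdisj : Disjoint (diagonal p h) (wordCells w (p + s.1.vec) (nextLength h s)) := by
      rw [← filter_diagIndex_eq_wordCells_cons s w, ← filter_diagIndex_lt_wordCells_cons]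
      exact Finset.disjoint_filter.2 fun q _ heq hlt => hlt.ne' heq
    rw [wordCells, Finset.card_union_of_disjoint hdisj, card_diagonal, ih, wordArea]

namespace IsBoundaryWord

variable {n h : ℕ} {w w' : List BoundaryStep} {p q : ℤ × ℤ}

theorem le_length (hw : IsBoundaryWord n h w) : h ≤ n := by
  cases hw with
  | nil => exact n.zero_le
  | cons _ le => exact le

theorem length_le_wordArea (hw : IsBoundaryWord n h w) : w.length ≤ wordArea h w := by
  induction hw with
  | nil => exact le_rfl
  | cons one_le _ _ ih => simp only [List.length_cons, wordArea]; omega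

theorem filter_diagIndex_eq (hw : IsBoundaryWord n h w) (p : ℤ × ℤ) :
    (wordCells w p h).filter (diagIndex · = diagIndex p) = diagonal p h := by
  cases hw with
  | nil => rfl
  | cons => exact filter_diagIndex_eq_wordCells_cons ..

theorem card_filter_diagIndex_le (hw : IsBoundaryWord n h w) (p : ℤ × ℤ) (k : ℤ) :
    ((wordCells w p h).filter (diagIndex · = k)).card ≤ n := by
  induction hw generalizing p with
  | nil => exact n.zero_le
  | @cons h s w _ le _ ih =>
    rcases eq_or_ne k (diagIndex p) with rfl | hk
    · rwa [filter_diagIndex_eq_wordCells_cons, card_diagonal]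
    · rw [wordCells, Finset.filter_union, Finset.filter_false_of_mem, Finset.empty_union]
      · exact ih _
      · exact fun q hq hqk => hk (hqk ▸ (mem_diagonal.1 hq).1)

theorem le_wordRows (hw : IsBoundaryWord n h w) : h ≤ wordRows w := by
  induction hw with
  | nil => exact Nat.zero_le _
  | @cons h s w _ _ _ ih =>
    obtain ⟨_ | _, _ | _⟩ := s <;>
      simp only [nextLength, wordRows_cons, reduceCtorEq, reduceIte] at ih ⊢ <;> omega

theorem le_wordCols (hw : IsBoundaryWord n h w) : h ≤ wordCols w := by
  induction hw with
  | nil => exact Nat.zero_le _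
  | @cons h s w _ _ _ ih =>
    obtain ⟨_ | _, _ | _⟩ := s <;>
      simp only [nextLength, wordCols_cons, reduceCtorEq, reduceIte] at ih ⊢ <;> omega

theorem image_fst_wordCells (hw : IsBoundaryWord n h w) (p : ℤ × ℤ) :
    (wordCells w p h).image Prod.fst = Finset.Ico p.1 (p.1 + wordRows w) := by
  induction hw generalizing p with
  | nil => simp [wordCells, wordRows]
  | @cons h s w one_le _ tail ih =>
    have hrows := tail.le_wordRows
    rw [wordCells, Finset.image_union, image_fst_diagonal, ih]
    ext i
    obtain ⟨_ | _, _ | _⟩ := s <;>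
      simp only [nextLength, wordRows_cons, Direction.vec, reduceCtorEq, reduceIte, Prod.fst_add,
        Finset.mem_union, Finset.mem_Ico] at hrows ⊢ <;> omega

theorem image_snd_wordCells (hw : IsBoundaryWord n h w) (p : ℤ × ℤ) :
    (wordCells w p h).image Prod.snd = Finset.Ico (p.2 + h - wordCols w) (p.2 + h) := by
  induction hw generalizing p with
  | nil => simp [wordCells, wordCols]
  | @cons h s w one_le _ tail ih =>
    have hcols := tail.le_wordCols
    rw [wordCells, Finset.image_union, image_snd_diagonal, ih]
    ext j
    obtain ⟨_ | _, _ | _⟩ := s <;>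
      simp only [nextLength, wordCols_cons, Direction.vec, reduceCtorEq, reduceIte, Prod.snd_add,
        Finset.mem_union, Finset.mem_Ico] at hcols ⊢ <;> omega

theorem row_mem_Ico (hw : IsBoundaryWord n h w) (hq : q ∈ wordCells w p h) :
    q.1 ∈ Finset.Ico p.1 (p.1 + wordRows w) :=
  hw.image_fst_wordCells p ▸ Finset.mem_image_of_mem _ hq

theorem col_mem_Ico (hw : IsBoundaryWord n h w) (hq : q ∈ wordCells w p h) :
    q.2 ∈ Finset.Ico (p.2 + h - wordCols w) (p.2 + h) :=
  hw.image_snd_wordCells p ▸ Finset.mem_image_of_mem _ hq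

theorem eq_of_wordCells_eq (hw : IsBoundaryWord n h w) (hw' : IsBoundaryWord n h w')
    (heq : wordCells w p h = wordCells w' p h) : w = w' := by
  induction hw generalizing w' p with
  | nil =>
    cases hw' with
    | nil => rfl
    | cons one_le => omega
  | @cons h s w one_le _ tail ih =>
    cases hw' with
    | nil => omega
    | @cons _ s' w' _ _ tail' =>
      have htail : wordCells w (p + s.1.vec) (nextLength h s) =
          wordCells w' (p + s'.1.vec) (nextLength h s') := by
        rw [← filter_diagIndex_lt_wordCells_cons, heq, filter_diagIndex_lt_wordCells_cons]
      obtain rfl : s = s' := diagonal_nextLength_injective one_le (p := p) <| by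
        dsimp only
        rw [← tail.filter_diagIndex_eq, htail, diagIndex_add_vec, ← diagIndex_add_vec p s'.1,
          tail'.filter_diagIndex_eq]
      rw [ih tail' htail]

theorem eq_of_wordCells_one_eq (hw : IsBoundaryWord n 1 w) (hw' : IsBoundaryWord n 1 w')
    (heq : wordCells w p 1 = wordCells w' q 1) : w = w' := by
  have hmem {u : List BoundaryStep} (hu : IsBoundaryWord n 1 u) (r : ℤ × ℤ) :
      r ∈ wordCells u r 1 :=
    Finset.filter_subset _ _ ((hu.filter_diagIndex_eq r).superset (left_mem_diagonal le_rfl))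
  have hindex : diagIndex p = diagIndex q :=
    le_antisymm (diagIndex_le_of_mem_wordCells (heq ▸ hmem hw' q))
      (diagIndex_le_of_mem_wordCells (heq ▸ hmem hw p))
  obtain rfl : p = q := by
    rw [← Finset.singleton_inj, ← diagonal_one, ← diagonal_one, ← hw.filter_diagIndex_eq,
      ← hw'.filter_diagIndex_eq, heq, hindex]
  exact hw.eq_of_wordCells_eq hw' heq

theorem mem_wordCells_of_diagIndex_eq (hw : IsBoundaryWord n h w)
    (hindex : diagIndex q = diagIndex p)
    (hlower : p ≤ q ∨ ∃ x ∈ wordCells w p h, x ≤ q)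
    (hupper : q ≤ lowerRight p h ∨ ∃ y ∈ wordCells w p h, q ≤ y) : q ∈ wordCells w p h := by
  refine Finset.filter_subset _ _
    ((hw.filter_diagIndex_eq p).superset (mem_diagonal.2 ⟨hindex, ?_⟩))
  have hp : p.1 ≤ q.1 := hlower.elim (·.1) fun ⟨x, hx, hxq⟩ =>
    (Finset.mem_Ico.1 (hw.row_mem_Ico hx)).1.trans hxq.1
  have hl : q.2 ≤ p.2 + h - 1 := hupper.elim (·.2) fun ⟨y, hy, hqy⟩ =>
    hqy.2.trans (Int.le_sub_one_of_lt (Finset.mem_Ico.1 (hw.col_mem_Ico hy)).2)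
  simp only [diagIndex, lowerRight, Prod.le_def] at hindex ⊢
  omega

/-- For squares not before the first diagonal, the ends of that diagonal act as extreme squares of
the shape; this is the form in which convexity passes to the tail of the word. -/
theorem mem_wordCells_of_between (hw : IsBoundaryWord n h w) (hindex : diagIndex p ≤ diagIndex q)
    (hlower : p ≤ q ∨ ∃ x ∈ wordCells w p h, x ≤ q)
    (hupper : q ≤ lowerRight p h ∨ ∃ y ∈ wordCells w p h, q ≤ y) : q ∈ wordCells w p h := by
  induction hw generalizing p with
  | nil =>
    simp only [wordCells, Finset.notMem_empty, false_and, exists_const, or_false, lowerRight,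
      Prod.le_def] at hlower hupper
    omega
  | @cons h s w one_le le tail ih =>
    rcases hindex.eq_or_lt with hindex | hindex
    · exact (cons one_le le tail).mem_wordCells_of_diagIndex_eq hindex.symm hlower hupper
    refine mem_wordCells_cons.2 (.inr (ih ?_ ?_ ?_))
    · rw [diagIndex_add_vec]
      omega
    · have hstep (hpq : p ≤ q) := add_vec_le s.1 hpq hindex
      rcases hlower with hpq | ⟨x, hx, hxq⟩
      · exact .inl (hstep hpq)
      · exact (mem_wordCells_cons.1 hx).imp (fun hx => hstep ((mem_diagonal.1 hx).2.1.trans hxq))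
          fun hx => ⟨x, hx, hxq⟩
    · have hstep (hq : q ≤ lowerRight p h) : q ≤ lowerRight (p + s.1.vec) (nextLength h s) := by
        rw [lowerRight_nextLength p one_le]
        exact le_add_vec s.2 hq ((diagIndex_lowerRight p h).trans_lt hindex)
      rcases hupper with hq | ⟨y, hy, hqy⟩
      · exact .inl (hstep hq)
      · exact (mem_wordCells_cons.1 hy).imp (fun hy => hstep (hqy.trans (mem_diagonal.1 hy).2.2))
          fun hy => ⟨y, hy, hqy⟩

theorem ordConnected_wordCells (hw : IsBoundaryWord n 1 w) (p : ℤ × ℤ) :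
    (wordCells w p 1 : Set (ℤ × ℤ)).OrdConnected := by
  refine ⟨fun x hx z hz y hy => hw.mem_wordCells_of_between ?_ (.inr ⟨x, hx, hy.1⟩)
    (.inr ⟨z, hz, hy.2⟩)⟩
  have hrow := (Finset.mem_Ico.1 (hw.row_mem_Ico hx)).1.trans hy.1.1
  have hcol := hy.2.2.trans_lt (Finset.mem_Ico.1 (hw.col_mem_Ico hz)).2
  simp only [diagIndex]
  omega

end IsBoundaryWord

/-- Two squares of the integer plane share an edge. -/
def IntShareEdge (u v : ℤ × ℤ) : Prop :=
  (u.1 = v.1 ∧ (u.2 + 1 = v.2 ∨ v.2 + 1 = u.2)) ∨ (u.2 = v.2 ∧ (u.1 + 1 = v.1 ∨ v.1 + 1 = u.1))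

theorem IntShareEdge.symm {u v : ℤ × ℤ} (huv : IntShareEdge u v) : IntShareEdge v u := by
  unfold IntShareEdge at *
  omega

theorem intShareEdge_add_vec (u : ℤ × ℤ) (d : Direction) : IntShareEdge u (u + d.vec) := by
  cases d <;> simp [IntShareEdge, Direction.vec]

theorem IntShareEdge.exists_add_vec_eq {u v : ℤ × ℤ} (huv : IntShareEdge u v)
    (h : diagIndex u < diagIndex v) : ∃ d : Direction, u + d.vec = v := by
  rcases huv with ⟨h₁, h₂⟩ | ⟨h₁, h₂⟩ <;> simp only [diagIndex] at h
  · exact ⟨.west, by ext <;> simp only [Direction.vec, Prod.fst_add, Prod.snd_add] <;> omega⟩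
  · exact ⟨.south, by ext <;> simp only [Direction.vec, Prod.fst_add, Prod.snd_add] <;> omega⟩

/-- Any two squares of `S` are joined by a sequence of squares of `S`, consecutive ones sharing an
edge. -/
def IsEdgeConnected (S : Finset (ℤ × ℤ)) : Prop :=
  ∀ u ∈ S, ∀ v ∈ S, Relation.ReflTransGen (fun a b => a ∈ S ∧ b ∈ S ∧ IntShareEdge a b) u v

namespace IsEdgeConnected

theorem singleton (p : ℤ × ℤ) : IsEdgeConnected {p} := by
  simp only [IsEdgeConnected, Finset.mem_singleton, forall_eq, Relation.ReflTransGen.refl]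

theorem union_of_forall_exists {S T : Finset (ℤ × ℤ)} (hT : IsEdgeConnected T)
    (hST : ∀ u ∈ S, ∃ v ∈ T, IntShareEdge u v) : IsEdgeConnected (S ∪ T) := by
  have hpath (u) (hu : u ∈ S ∪ T) : ∃ v ∈ T,
      Relation.ReflTransGen (fun a b => a ∈ S ∪ T ∧ b ∈ S ∪ T ∧ IntShareEdge a b) u v := by
    rcases Finset.mem_union.1 hu with huS | huT
    · obtain ⟨v, hv, huv⟩ := hST u huS
      exact ⟨v, hv, .single ⟨hu, Finset.mem_union_right _ hv, huv⟩⟩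
    · exact ⟨u, huT, .refl⟩
  intro u hu v hv
  obtain ⟨u', hu', huu'⟩ := hpath u hu
  obtain ⟨v', hv', hvv'⟩ := hpath v hv
  have hsymm : Std.Symm fun a b => a ∈ S ∪ T ∧ b ∈ S ∪ T ∧ IntShareEdge a b :=
    ⟨fun a b h => ⟨h.2.1, h.1, h.2.2.symm⟩⟩
  refine huu'.trans (.trans ?_ (Relation.ReflTransGen.stdSymm.symm _ _ hvv'))
  exact (hT u' hu' v' hv').lift id fun a b h =>
    ⟨Finset.mem_union_right S h.1, Finset.mem_union_right S h.2.1, h.2.2⟩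

/-- Along a path the index of the diagonal changes by at most one at a time. -/
theorem exists_add_vec_mem {S : Finset (ℤ × ℤ)} (hS : IsEdgeConnected S) {x y : ℤ × ℤ} (hx : x ∈ S)
    (hy : y ∈ S) {c : ℤ} (hxc : diagIndex x ≤ c) (hcy : c < diagIndex y) :
    ∃ u ∈ S, diagIndex u = c ∧ ∃ d : Direction, u + d.vec ∈ S := by
  have hpath := hS x hx y hy
  induction hpath with
  | refl => exact absurd hxc hcy.not_ge
  | @tail u v _ huv ih =>
    rcases lt_or_ge c (diagIndex u) with hcu | huc
    · exact ih huv.1 hcu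
    · obtain ⟨d, rfl⟩ := huv.2.2.exists_add_vec_eq (huc.trans_lt hcy)
      rw [diagIndex_add_vec] at hcy
      exact ⟨u, huv.1, by omega, d, huv.2.1⟩

end IsEdgeConnected

theorem exists_add_vec_mem_diagonal {p u : ℤ × ℤ} {h : ℕ} {s : BoundaryStep}
    (hpos : 1 ≤ nextLength h s) (hu : u ∈ diagonal p h) :
    ∃ d : Direction, u + d.vec ∈ diagonal (p + s.1.vec) (nextLength h s) := by
  have one_le : 1 ≤ h := card_diagonal p h ▸ Finset.card_pos.2 ⟨u, hu⟩
  obtain ⟨hindex, hpu, hul⟩ := mem_diagonal.1 hu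
  have hends := (mem_diagonal.1 (left_mem_diagonal (p := p + s.1.vec) hpos)).2.2
  simp only [mem_diagonal, diagIndex_add_vec, hindex, true_and]
  rw [lowerRight_nextLength p one_le] at hends ⊢
  rcases eq_or_ne u (lowerRight p h) with rfl | hlast
  · exact ⟨s.2, hends, le_rfl⟩
  · refine ⟨s.1, by gcongr, ?_⟩
    obtain ⟨_ | _, _ | _⟩ := s <;>
      simp only [diagIndex, lowerRight, Direction.vec, Prod.le_def, ne_eq, Prod.ext_iff,
        Prod.fst_add, Prod.snd_add] at * <;> omega

theorem IsBoundaryWord.isEdgeConnected_wordCells {n h : ℕ} {w : List BoundaryStep}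
    (hw : IsBoundaryWord n h w) (p : ℤ × ℤ) : IsEdgeConnected (wordCells w p h) := by
  induction hw generalizing p with
  | nil => simp [IsEdgeConnected, wordCells]
  | @cons h s w one_le _ tail ih =>
    rcases (nextLength h s).eq_zero_or_pos with hzero | hpos
    · rw [hzero] at tail
      obtain rfl : w = [] := by cases tail <;> first | rfl | omega
      obtain rfl : h = 1 := by
        obtain ⟨_ | _, _ | _⟩ := s <;> simp only [nextLength] at hzero <;> omega
      rw [wordCells, wordCells, Finset.union_empty, diagonal_one]
      exact .singleton p
    · refine (ih _).union_of_forall_exists fun u hu => ?_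
      obtain ⟨d, hd⟩ := exists_add_vec_mem_diagonal hpos hu
      exact ⟨_, Finset.filter_subset _ _ ((tail.filter_diagIndex_eq _).superset hd),
        intShareEdge_add_vec u d⟩

section OrdConnected

variable {S : Finset (ℤ × ℤ)}

theorem exists_add_vec_mem_of_diagIndex_lt (hconv : (S : Set (ℤ × ℤ)).OrdConnected)
    (hconn : IsEdgeConnected S) {p r : ℤ × ℤ} (hp : p ∈ S) (hr : r ∈ S)
    (hpr : diagIndex p < diagIndex r) : ∃ d : Direction, p + d.vec ∈ S := by
  obtain ⟨u, hu, hindex, d, hd⟩ := hconn.exists_add_vec_mem hp hr le_rfl hpr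
  rcases lt_trichotomy u.1 p.1 with hlt | heq | hgt
  · refine ⟨.west, hconv.out hu hp ?_⟩
    simp only [diagIndex, Direction.vec, Set.mem_Icc, Prod.le_def, Prod.fst_add, Prod.snd_add] at *
    omega
  · obtain rfl : u = p := by
      ext
      exacts [heq, by simp only [diagIndex] at hindex; omega]
    exact ⟨d, hd⟩
  · refine ⟨.south, hconv.out hp hu ?_⟩
    simp only [diagIndex, Direction.vec, Set.mem_Icc, Prod.le_def, Prod.fst_add, Prod.snd_add] at *
    omega

theorem exists_sub_vec_mem_of_diagIndex_lt (hconv : (S : Set (ℤ × ℤ)).OrdConnected)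
    (hconn : IsEdgeConnected S) {q r : ℤ × ℤ} (hq : q ∈ S) (hr : r ∈ S)
    (hrq : diagIndex r < diagIndex q) : ∃ d : Direction, q - d.vec ∈ S := by
  obtain ⟨u, hu, hindex, d, hd⟩ :=
    hconn.exists_add_vec_mem hr hq (Int.le_sub_one_of_lt hrq) (sub_one_lt (diagIndex q))
  have hindex' : diagIndex (u + d.vec) = diagIndex q := by rw [diagIndex_add_vec]; omega
  rcases lt_trichotomy (u + d.vec).1 q.1 with hlt | heq | hgt
  · refine ⟨.south, hconv.out hd hq ?_⟩
    simp only [diagIndex, Direction.vec, Set.mem_Icc, Prod.le_def, Prod.fst_sub, Prod.snd_sub] at *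
    omega
  · obtain rfl : u + d.vec = q := by
      ext
      exacts [heq, by simp only [diagIndex] at hindex'; omega]
    exact ⟨d, by rwa [add_sub_cancel_right]⟩
  · refine ⟨.west, hconv.out hq hd ?_⟩
    simp only [diagIndex, Direction.vec, Set.mem_Icc, Prod.le_def, Prod.fst_sub, Prod.snd_sub] at *
    omega

theorem exists_direction_of_first (hconv : (S : Set (ℤ × ℤ)).OrdConnected)
    (hconn : IsEdgeConnected S) {p : ℤ × ℤ} (hp : p ∈ S)
    (hfirst : ∀ x ∈ S, diagIndex x = diagIndex p → p ≤ x) :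
    ∃ d : Direction, (∃ x ∈ S, x ≤ p + d.vec) ∧
      ∀ q ∈ S, diagIndex q = diagIndex p + 1 → p + d.vec ≤ q := by
  have hbound (q) (hq : q ∈ S) (hindex : diagIndex q = diagIndex p + 1) :
      ∃ e : Direction, p + e.vec ≤ q := by
    obtain ⟨e, he⟩ := exists_sub_vec_mem_of_diagIndex_lt hconv hconn hq hp (by omega)
    have hprev := diagIndex_add_vec (q - e.vec) e
    rw [sub_add_cancel] at hprev
    exact ⟨e, le_sub_iff_add_le.1 (hfirst _ he (by omega))⟩
  by_cases hwest : p + Direction.west.vec ∈ S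
  · refine ⟨.west, ⟨_, hwest, le_rfl⟩, fun q hq hindex => ?_⟩
    obtain ⟨_ | _, he⟩ := hbound q hq hindex
    · refine le_trans ?_ he
      simp [Direction.vec, Prod.le_def]
    · exact he
  · refine ⟨.south, ⟨p, hp, by simp [Direction.vec, Prod.le_def]⟩, fun q hq hindex => ?_⟩
    have hne : q ≠ p + Direction.west.vec := fun h => hwest (h ▸ hq)
    obtain ⟨_ | _, he⟩ := hbound q hq hindex
    · exact he
    · simp only [diagIndex, Direction.vec, Prod.le_def, Prod.fst_add, Prod.snd_add, ne_eq,
        Prod.ext_iff] at *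
      omega

theorem exists_direction_of_last (hconv : (S : Set (ℤ × ℤ)).OrdConnected)
    (hconn : IsEdgeConnected S) {l : ℤ × ℤ} (hl : l ∈ S)
    (hlast : ∀ x ∈ S, diagIndex x = diagIndex l → x ≤ l) :
    ∃ d : Direction, (∃ y ∈ S, l + d.vec ≤ y) ∧
      ∀ q ∈ S, diagIndex q = diagIndex l + 1 → q ≤ l + d.vec := by
  have hbound (q) (hq : q ∈ S) (hindex : diagIndex q = diagIndex l + 1) :
      ∃ e : Direction, q ≤ l + e.vec := by
    obtain ⟨e, he⟩ := exists_sub_vec_mem_of_diagIndex_lt hconv hconn hq hl (by omega)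
    have hprev := diagIndex_add_vec (q - e.vec) e
    rw [sub_add_cancel] at hprev
    exact ⟨e, sub_le_iff_le_add.1 (hlast _ he (by omega))⟩
  by_cases hsouth : l + Direction.south.vec ∈ S
  · refine ⟨.south, ⟨_, hsouth, le_rfl⟩, fun q hq hindex => ?_⟩
    obtain ⟨_ | _, he⟩ := hbound q hq hindex
    · exact he
    · refine he.trans ?_
      simp [Direction.vec, Prod.le_def]
  · refine ⟨.west, ⟨l, hl, by simp [Direction.vec, Prod.le_def]⟩, fun q hq hindex => ?_⟩
    have hne : q ≠ l + Direction.south.vec := fun h => hsouth (h ▸ hq)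
    obtain ⟨_ | _, he⟩ := hbound q hq hindex
    · simp only [diagIndex, Direction.vec, Prod.le_def, Prod.fst_add, Prod.snd_add, ne_eq,
        Prod.ext_iff] at *
      omega
    · exact he

theorem exists_boundaryStep (hconv : (S : Set (ℤ × ℤ)).OrdConnected) (hconn : IsEdgeConnected S)
    {p : ℤ × ℤ} {h : ℕ} (one_le : 1 ≤ h)
    (hdiag : S.filter (diagIndex · = diagIndex p) = diagonal p h) :
    ∃ s : BoundaryStep, S.filter (diagIndex · = diagIndex p + 1) =
      diagonal (p + s.1.vec) (nextLength h s) := by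
  have hbounds (x) (hx : x ∈ S) (hindex : diagIndex x = diagIndex p) :
      p ≤ x ∧ x ≤ lowerRight p h :=
    (mem_diagonal.1 (hdiag ▸ Finset.mem_filter.2 ⟨hx, hindex⟩)).2
  have hp : p ∈ S := Finset.filter_subset _ _ (hdiag.superset (left_mem_diagonal one_le))
  have hl : lowerRight p h ∈ S :=
    Finset.filter_subset _ _ (hdiag.superset (lowerRight_mem_diagonal one_le))
  obtain ⟨d, ⟨x, hx, hxd⟩, hd⟩ :=
    exists_direction_of_first hconv hconn hp fun x hx hi => (hbounds x hx hi).1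
  obtain ⟨e, ⟨y, hy, hey⟩, he⟩ := exists_direction_of_last hconv hconn hl fun x hx hi =>
    (hbounds x hx (hi.trans (diagIndex_lowerRight p h))).2
  rw [diagIndex_lowerRight] at he
  refine ⟨(d, e), Finset.ext fun q => ?_⟩
  rw [Finset.mem_filter, mem_diagonal, lowerRight_nextLength p one_le, diagIndex_add_vec]
  exact ⟨fun ⟨hq, hi⟩ => ⟨hi, hd q hq hi, he q hq hi⟩,
    fun ⟨hi, hdq, hqe⟩ => ⟨hconv.out hx hy ⟨hxd.trans hdq, hqe.trans hey⟩, hi⟩⟩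

theorem exists_boundaryWord_of_diagonal {n : ℕ} (hconv : (S : Set (ℤ × ℤ)).OrdConnected)
    (hconn : IsEdgeConnected S) (hn : ∀ k, (S.filter (diagIndex · = k)).card ≤ n)
    {p : ℤ × ℤ} {h : ℕ} (hdiag : S.filter (diagIndex · = diagIndex p) = diagonal p h)
    (hzero : h = 0 → S.filter (diagIndex p ≤ diagIndex ·) = ∅) :
    ∃ w, IsBoundaryWord n h w ∧ wordCells w p h = S.filter (diagIndex p ≤ diagIndex ·) := by
  induction hcard : (S.filter (diagIndex p ≤ diagIndex ·)).card using Nat.strong_induction_on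
    generalizing p h with | _ N ih
  rcases h.eq_zero_or_pos with rfl | one_le
  · exact ⟨[], .nil, (hzero rfl).symm⟩
  have hp : p ∈ S.filter (diagIndex · = diagIndex p) := hdiag ▸ left_mem_diagonal one_le
  rw [Finset.mem_filter] at hp
  obtain ⟨s, hs⟩ := exists_boundaryStep hconv hconn one_le hdiag
  have hindex := diagIndex_add_vec p s.1
  have hsplit : S.filter (diagIndex p ≤ diagIndex ·) =
      diagonal p h ∪ S.filter (diagIndex (p + s.1.vec) ≤ diagIndex ·) := by
    rw [← hdiag, ← Finset.filter_or, hindex]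
    exact Finset.filter_congr fun q _ => by omega
  have hlt : (S.filter (diagIndex (p + s.1.vec) ≤ diagIndex ·)).card < N := by
    rw [← hcard, hsplit]
    refine Finset.card_lt_card (Finset.ssubset_iff_subset_ne.2 ⟨Finset.subset_union_right, ?_⟩)
    intro heq
    have := (Finset.mem_filter.1
      (heq.superset (Finset.mem_union_left _ (left_mem_diagonal one_le)))).2
    omega
  have hzero' (hlen : nextLength h s = 0) :
      S.filter (diagIndex (p + s.1.vec) ≤ diagIndex ·) = ∅ := by
    rw [hlen, diagonal_zero] at hs
    refine Finset.filter_eq_empty_iff.2 fun r hr hpr => ?_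
    obtain ⟨d, hd⟩ := exists_add_vec_mem_of_diagIndex_lt hconv hconn hp.1 hr (by omega)
    exact Finset.filter_eq_empty_iff.1 hs hd (diagIndex_add_vec p d)
  obtain ⟨w, hw, hcells⟩ := ih _ hlt (hindex ▸ hs) hzero' rfl
  have le : h ≤ n := by simpa only [hdiag, card_diagonal] using hn (diagIndex p)
  exact ⟨s :: w, .cons one_le le hw, by rw [wordCells, hcells, hsplit]⟩

theorem eq_of_diagIndex_eq_of_forall_le (hconv : (S : Set (ℤ × ℤ)).OrdConnected) {p q : ℤ × ℤ}
    (hp : p ∈ S) (hq : q ∈ S) (hpq : diagIndex p = diagIndex q)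
    (hmin : ∀ r ∈ S, diagIndex p ≤ diagIndex r) : p = q := by
  wlog hle : p.1 ≤ q.1 generalizing p q
  · exact (this hq hp hpq.symm (hpq ▸ hmin) (le_of_not_ge hle)).symm
  by_contra hne
  have hmem : p + (0, 1) ∈ S := hconv.out hp hq (by
    simp only [diagIndex, Set.mem_Icc, Prod.le_def, Prod.fst_add, Prod.snd_add, Prod.ext_iff] at *
    omega)
  have := hmin _ hmem
  simp only [diagIndex, Prod.fst_add, Prod.snd_add] at this
  omega

theorem exists_boundaryWord {n : ℕ} (hne : S.Nonempty) (hconv : (S : Set (ℤ × ℤ)).OrdConnected)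
    (hconn : IsEdgeConnected S) (hn : ∀ k, (S.filter (diagIndex · = k)).card ≤ n) :
    ∃ w p, IsBoundaryWord n 1 w ∧ wordCells w p 1 = S := by
  obtain ⟨p, hp, hmin⟩ := S.exists_min_image diagIndex hne
  have hdiag : S.filter (diagIndex · = diagIndex p) = diagonal p 1 := by
    rw [diagonal_one]
    refine Finset.eq_singleton_iff_unique_mem.2 ⟨Finset.mem_filter.2 ⟨hp, rfl⟩, fun q hq => ?_⟩
    obtain ⟨hq, hindex⟩ := Finset.mem_filter.1 hq
    exact (eq_of_diagIndex_eq_of_forall_le hconv hp hq hindex.symm hmin).symm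
  obtain ⟨w, hw, hcells⟩ :=
    exists_boundaryWord_of_diagonal hconv hconn hn hdiag fun h => absurd h one_ne_zero
  exact ⟨w, p, hw, hcells.trans (Finset.filter_true_of_mem hmin)⟩

end OrdConnected

theorem ordConnected_iff_exists_youngDiagram_sdiff {T : Finset (ℕ × ℕ)} :
    (T : Set (ℕ × ℕ)).OrdConnected ↔
      ∃ σ ρ : YoungDiagram, ρ ≤ σ ∧ T = σ.cells \ ρ.cells := by
  constructor
  · intro hT
    have hmem (y) : y ∈ T.biUnion Finset.Iic ↔ ∃ t ∈ T, y ≤ t := by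
      simp only [Finset.mem_biUnion, Finset.mem_Iic]
    refine ⟨⟨T.biUnion Finset.Iic, ?_⟩, ⟨T.biUnion Finset.Iic \ T, ?_⟩, Finset.sdiff_subset,
      (Finset.sdiff_sdiff_eq_self fun t ht => (hmem t).2 ⟨t, ht, le_rfl⟩).symm⟩
    · intro y x hxy hy
      rw [Finset.mem_coe, hmem] at hy ⊢
      exact hy.imp fun t ht => ⟨ht.1, hxy.trans ht.2⟩
    · intro y x hxy hy
      rw [Finset.mem_coe, Finset.mem_sdiff, hmem] at hy ⊢
      obtain ⟨⟨t, ht, hyt⟩, hyT⟩ := hy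
      exact ⟨⟨t, ht, hxy.trans hyt⟩, fun hx => hyT (hT.out hx ht ⟨hxy, hyt⟩)⟩
  · rintro ⟨σ, ρ, -, rfl⟩
    rw [Finset.coe_sdiff]
    exact σ.isLowerSet.ordConnected.inter ρ.isLowerSet.compl.ordConnected

/-- The embedding of the squares into the integer plane, in which shapes are translated freely. -/
def intSquare (c : ℕ × ℕ) : ℤ × ℤ := (c.1, c.2)

theorem intSquare_injective : Function.Injective intSquare :=
  PlacedConnectedSkewShape.cast_injective

theorem intSquare_le {u v : ℕ × ℕ} : intSquare u ≤ intSquare v ↔ u ≤ v := by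
  simp only [intSquare, Prod.le_def, Nat.cast_le]

theorem intShareEdge_intSquare {u v : ℕ × ℕ} :
    IntShareEdge (intSquare u) (intSquare v) ↔ ShareEdge u v := by
  simp only [IntShareEdge, ShareEdge, intSquare]
  omega

theorem exists_intSquare_eq {x : ℤ × ℤ} (hx : 0 ≤ x) : ∃ c, intSquare c = x :=
  ⟨(x.1.toNat, x.2.toNat), Prod.ext (Int.toNat_of_nonneg hx.1) (Int.toNat_of_nonneg hx.2)⟩

namespace PlacedConnectedSkewShape

/-- The squares of a placed shape as a subset of the integer plane. -/
def intCells (α : PlacedConnectedSkewShape) : Finset (ℤ × ℤ) := α.cells.image intSquare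

theorem isTranslate_iff {α β : PlacedConnectedSkewShape} :
    IsTranslate α β ↔ ∃ v : ℤ × ℤ, β.intCells = α.intCells.image (· + v) := by
  simp only [intCells, Finset.image_image, Prod.exists]
  rfl

theorem card_image_fst_intCells (α : PlacedConnectedSkewShape) :
    (α.intCells.image Prod.fst).card = α.row := by
  rw [intCells, Finset.image_image, row,
    ← Finset.card_image_of_injective _ (Nat.cast_injective (R := ℤ)), Finset.image_image]
  rfl

theorem card_image_snd_intCells (α : PlacedConnectedSkewShape) :
    (α.intCells.image Prod.snd).card = α.col := by
  rw [intCells, Finset.image_image, col,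
    ← Finset.card_image_of_injective _ (Nat.cast_injective (R := ℤ)), Finset.image_image]
  rfl

theorem card_intCells (α : PlacedConnectedSkewShape) : α.intCells.card = α.area :=
  Finset.card_image_of_injective _ intSquare_injective

theorem card_filter_diagIndex_intCells (α : PlacedConnectedSkewShape) (k : ℤ) :
    (α.intCells.filter (diagIndex · = k)).card = α.diagLength k := by
  rw [intCells, Finset.filter_image, Finset.card_image_of_injective _ intSquare_injective]
  rfl

theorem ordConnected_intCells (α : PlacedConnectedSkewShape) :
    (α.intCells : Set (ℤ × ℤ)).OrdConnected := by
  have hconv := ordConnected_iff_exists_youngDiagram_sdiff.2 α.isSkew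
  refine ⟨fun x hx z hz y hy => ?_⟩
  obtain ⟨x, hx', rfl⟩ := Finset.mem_image.1 hx
  obtain ⟨z, hz', rfl⟩ := Finset.mem_image.1 hz
  obtain ⟨y, rfl⟩ := exists_intSquare_eq
    (le_trans ⟨Int.natCast_nonneg x.1, Int.natCast_nonneg x.2⟩ hy.1)
  simp only [Set.mem_Icc, intSquare_le] at hy
  exact Finset.mem_image_of_mem _ (hconv.out hx' hz' hy)

theorem isEdgeConnected_intCells (α : PlacedConnectedSkewShape) : IsEdgeConnected α.intCells := by
  intro x hx y hy
  obtain ⟨x, hx', rfl⟩ := Finset.mem_image.1 hx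
  obtain ⟨y, hy', rfl⟩ := Finset.mem_image.1 hy
  exact (α.connected x hx' y hy').lift intSquare fun u v huv =>
    ⟨Finset.mem_image_of_mem _ huv.1, Finset.mem_image_of_mem _ huv.2.1,
      intShareEdge_intSquare.2 huv.2.2⟩

theorem exists_intCells_eq {S : Finset (ℤ × ℤ)} (hnonneg : ∀ x ∈ S, 0 ≤ x) (hne : S.Nonempty)
    (hconv : (S : Set (ℤ × ℤ)).OrdConnected) (hconn : IsEdgeConnected S) :
    ∃ α : PlacedConnectedSkewShape, α.intCells = S := by
  obtain ⟨T, -, rfl⟩ := Finset.subset_set_image_iff.1 fun x (hx : x ∈ S) =>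
    Set.image_univ.superset (exists_intSquare_eq (hnonneg x hx))
  have hmem {c : ℕ × ℕ} : intSquare c ∈ T.image intSquare ↔ c ∈ T :=
    intSquare_injective.mem_finset_image
  refine ⟨⟨T, ordConnected_iff_exists_youngDiagram_sdiff.1 ⟨?_⟩, hne.of_image, ?_⟩, rfl⟩
  · intro x hx z hz y hy
    exact hmem.1 (hconv.out (hmem.2 hx) (hmem.2 hz) ⟨intSquare_le.2 hy.1, intSquare_le.2 hy.2⟩)
  · intro u hu v hv
    have hinv := Function.leftInverse_invFun intSquare_injective
    rw [← hinv u, ← hinv v]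
    refine (hconn _ (hmem.2 hu) _ (hmem.2 hv)).lift (Function.invFun intSquare) ?_
    rintro a b ⟨ha, hb, hab⟩
    obtain ⟨a, -, rfl⟩ := Finset.mem_image.1 ha
    obtain ⟨b, -, rfl⟩ := Finset.mem_image.1 hb
    simp only [Function.onFun, hinv a, hinv b]
    exact ⟨hmem.1 ha, hmem.1 hb, intShareEdge_intSquare.1 hab⟩

variable {n : ℕ}

theorem exists_intCells_eq_wordCells {w : List BoundaryStep} (hw : IsBoundaryWord n 1 w) :
    ∃ (α : PlacedConnectedSkewShape) (p : ℤ × ℤ), α.intCells = wordCells w p 1 := by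
  have hnonneg (x) (hx : x ∈ wordCells w (0, wordCols w - 1) 1) : 0 ≤ x := by
    have hcol := (Finset.mem_Ico.1 (hw.col_mem_Ico hx)).1
    exact ⟨(Finset.mem_Ico.1 (hw.row_mem_Ico hx)).1, hcol.trans' (by simp)⟩
  have hfirst := (hw.filter_diagIndex_eq (0, wordCols w - 1)).superset (left_mem_diagonal le_rfl)
  obtain ⟨α, hα⟩ := exists_intCells_eq hnonneg ⟨_, Finset.filter_subset _ _ hfirst⟩
    (hw.ordConnected_wordCells _) (hw.isEdgeConnected_wordCells _)
  exact ⟨α, _, hα⟩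

/-- A placed shape with a given word. The choice of the place does not matter, since only the class
up to translation is used. -/
noncomputable def ofBoundaryWord (w : {w // IsBoundaryWord n 1 w}) : PlacedConnectedSkewShape :=
  (exists_intCells_eq_wordCells w.2).choose

theorem exists_intCells_ofBoundaryWord_eq (w : {w // IsBoundaryWord n 1 w}) :
    ∃ p, (ofBoundaryWord w).intCells = wordCells w.1 p 1 :=
  (exists_intCells_eq_wordCells w.2).choose_spec

theorem diagLE_ofBoundaryWord (w : {w // IsBoundaryWord n 1 w}) : (ofBoundaryWord w).DiagLE n := by
  obtain ⟨p, hp⟩ := exists_intCells_ofBoundaryWord_eq w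
  intro k
  rw [← card_filter_diagIndex_intCells, hp]
  exact w.2.card_filter_diagIndex_le p k

theorem row_ofBoundaryWord (w : {w // IsBoundaryWord n 1 w}) :
    (ofBoundaryWord w).row = wordRows w.1 := by
  obtain ⟨p, hp⟩ := exists_intCells_ofBoundaryWord_eq w
  rw [← card_image_fst_intCells, hp, w.2.image_fst_wordCells, Int.card_Ico, add_sub_cancel_left,
    Int.toNat_natCast]

theorem col_ofBoundaryWord (w : {w // IsBoundaryWord n 1 w}) :
    (ofBoundaryWord w).col = wordCols w.1 := by
  obtain ⟨p, hp⟩ := exists_intCells_ofBoundaryWord_eq w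
  rw [← card_image_snd_intCells, hp, w.2.image_snd_wordCells, Int.card_Ico, sub_sub_cancel,
    Int.toNat_natCast]

theorem area_ofBoundaryWord (w : {w // IsBoundaryWord n 1 w}) :
    (ofBoundaryWord w).area = wordArea 1 w.1 := by
  obtain ⟨p, hp⟩ := exists_intCells_ofBoundaryWord_eq w
  rw [← card_intCells, hp, card_wordCells]

end PlacedConnectedSkewShape

open PlacedConnectedSkewShape

/-- The connected skew shape, up to translation, with a given word. -/
noncomputable def shapeOfWord (n : ℕ) (w : {w // IsBoundaryWord n 1 w}) : BoundedSkewShape n :=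
  ⟨Quotient.mk _ (ofBoundaryWord w), diagLE_ofBoundaryWord w⟩

theorem shapeOfWord_injective (n : ℕ) : Function.Injective (shapeOfWord n) := by
  intro w w' heq
  have htrans : IsTranslate (ofBoundaryWord w) (ofBoundaryWord w') :=
    Quotient.exact (congrArg Subtype.val heq)
  obtain ⟨v, hv⟩ := isTranslate_iff.1 htrans
  obtain ⟨p, hp⟩ := exists_intCells_ofBoundaryWord_eq w
  obtain ⟨p', hp'⟩ := exists_intCells_ofBoundaryWord_eq w'
  rw [hp, hp', image_add_wordCells] at hv
  exact Subtype.ext (w'.2.eq_of_wordCells_one_eq w.2 hv).symm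

theorem shapeOfWord_surjective (n : ℕ) : Function.Surjective (shapeOfWord n) := by
  rintro ⟨α, hα⟩
  induction α using Quotient.inductionOn with
  | h α =>
    obtain ⟨w, p, hw, hcells⟩ := exists_boundaryWord (n := n) (α.nonempty.image _)
      α.ordConnected_intCells α.isEdgeConnected_intCells
      fun k => (α.card_filter_diagIndex_intCells k).trans_le (hα k)
    obtain ⟨p', hp'⟩ := exists_intCells_ofBoundaryWord_eq ⟨w, hw⟩
    refine ⟨⟨w, hw⟩, Subtype.ext (Quotient.sound (isTranslate_iff.2 ⟨p - p', ?_⟩))⟩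
    rw [hp', image_add_wordCells, add_sub_cancel, hcells, intCells]

theorem summable_of_X_pow_dvd {ι σ R : Type*} [CommSemiring R] [TopologicalSpace R] (s : σ)
    {f : ι → MvPowerSeries σ R} {e : ι → ℕ} (he : Filter.Tendsto e Filter.cofinite Filter.atTop)
    (hf : ∀ i, MvPowerSeries.X s ^ e i ∣ f i) : Summable f := by
  rw [MvPowerSeries.WithPiTopology.summable_iff_summable_coeff]
  intro d
  refine summable_of_hasFiniteSupport
    ((Filter.eventually_cofinite.1 (he.eventually_gt_atTop (d s))).subset fun i hi hlt => hi ?_)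
  exact MvPowerSeries.X_pow_dvd_iff.1 (hf i) d hlt

/-- The term `(q^ν z²)^col (q^ν)^row q^area` of the shape of a word with first diagonal of length
`h`. -/
noncomputable def wordWeight (h : ℕ) (w : List BoundaryStep) : PSeries :=
  (qNu * zVar ^ 2) ^ wordCols w * qNu ^ wordRows w * qVar ^ wordArea h w

/-- The contribution of one step of the boundary to the row and column variables. -/
noncomputable def stepWeight : BoundaryStep → PSeries
  | (.south, .west) => (qNu * zVar) ^ 2
  | (.west, .south) => 1
  | (.south, .south) => qNu
  | (.west, .west) => qNu * zVar ^ 2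

theorem wordWeight_cons (h : ℕ) (s : BoundaryStep) (w : List BoundaryStep) :
    wordWeight h (s :: w) = qVar ^ h * stepWeight s * wordWeight (nextLength h s) w := by
  obtain ⟨_ | _, _ | _⟩ := s <;>
    simp only [wordWeight, wordRows_cons, wordCols_cons, wordArea, stepWeight, nextLength,
      reduceCtorEq, reduceIte] <;> ring

theorem shapeWeight_shapeOfWord {n : ℕ} (w : {w // IsBoundaryWord n 1 w}) :
    shapeWeight (shapeOfWord n w).1 = wordWeight 1 w.1 := by
  rw [wordWeight, ← col_ofBoundaryWord, ← row_ofBoundaryWord, ← area_ofBoundaryWord]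
  rfl

theorem summable_wordWeight (n h : ℕ) :
    Summable fun w : {w // IsBoundaryWord n h w} => wordWeight h w.1 := by
  refine summable_of_X_pow_dvd 1 (e := fun w => wordArea h w.1) ?_ fun w => Dvd.intro_left _ rfl
  refine Filter.tendsto_atTop.2 fun N => Filter.eventually_cofinite.2 ?_
  refine ((List.finite_length_le BoundaryStep N).preimage Subtype.val_injective.injOn).subset ?_
  exact fun w hw => w.2.length_le_wordArea.trans (le_of_not_ge hw)

/-- The generating function of the boundary words whose first diagonal has length `h`. -/
noncomputable def wordSum (n h : ℕ) : PSeries :=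
  ∑' w : {w // IsBoundaryWord n h w}, wordWeight h w.1

theorem hasSum_shapeWeight (n : ℕ) :
    HasSum (fun α : BoundedSkewShape n => shapeWeight α.1) (wordSum n 1) := by
  have hbij : Function.Bijective (shapeOfWord n) :=
    ⟨shapeOfWord_injective n, shapeOfWord_surjective n⟩
  rw [← (Equiv.ofBijective _ hbij).hasSum_iff,
    show _ ∘ _ = fun w => wordWeight 1 w.1 from funext shapeWeight_shapeOfWord]
  exact (summable_wordWeight n 1).hasSum

theorem wordSum_zero (n : ℕ) : wordSum n 0 = 1 := by
  have hnil (w : {w // IsBoundaryWord n 0 w}) : w = ⟨[], .nil⟩ := by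
    rcases w with ⟨_, _ | one_le⟩
    · rfl
    · omega
  rw [wordSum, tsum_eq_single ⟨[], .nil⟩ fun w hw => absurd (hnil w) hw]
  simp only [wordWeight, wordCols, wordRows, wordArea, List.map_nil, List.count_nil, pow_zero,
    mul_one]

theorem wordSum_eq_zero {n h : ℕ} (hh : n < h) : wordSum n h = 0 := by
  have : IsEmpty {w // IsBoundaryWord n h w} := ⟨fun w => w.2.le_length.not_gt hh⟩
  exact tsum_empty

theorem IsBoundaryWord.cons_bijective {n h : ℕ} (one_le : 1 ≤ h) (le : h ≤ n) :
    Function.Bijective fun x : Σ s : BoundaryStep, {w // IsBoundaryWord n (nextLength h s) w} =>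
      (⟨x.1 :: x.2.1, .cons one_le le x.2.2⟩ : {w // IsBoundaryWord n h w}) := by
  constructor
  · rintro ⟨s, w, hw⟩ ⟨s', w', hw'⟩ heq
    obtain ⟨rfl, rfl⟩ := List.cons.inj (congrArg Subtype.val heq)
    rfl
  · rintro ⟨_, _ | ⟨_, _, tail⟩⟩
    · omega
    · exact ⟨⟨_, _, tail⟩, rfl⟩

theorem wordSum_eq_mul_sum {n h : ℕ} (one_le : 1 ≤ h) (le : h ≤ n) :
    wordSum n h = qVar ^ h * ∑ s, stepWeight s * wordSum n (nextLength h s) := by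
  let e := Equiv.ofBijective _ (IsBoundaryWord.cons_bijective one_le le)
  have hsum := e.summable_iff.2 (summable_wordWeight n h)
  calc wordSum n h = ∑' x, wordWeight h (e x).1 := (e.tsum_eq _).symm
    _ = ∑ s, ∑' w, wordWeight h (e ⟨s, w⟩).1 := hsum.tsum_sigma.trans (tsum_fintype _)
    _ = ∑ s, qVar ^ h * stepWeight s * wordSum n (nextLength h s) := by
      refine Finset.sum_congr rfl fun s _ => ?_
      rw [wordSum, ← (summable_wordWeight n _).tsum_mul_left]
      exact tsum_congr fun w => wordWeight_cons h s w.1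
    _ = qVar ^ h * ∑ s, stepWeight s * wordSum n (nextLength h s) := by
      simp only [Finset.mul_sum, mul_assoc]

theorem wordSum_succ {n k : ℕ} (hk : k + 1 ≤ n) :
    wordSum n (k + 1) = qVar ^ (k + 1) * (qNu * wordSum n (k + 1) + wordSum n (k + 2) +
      (qNu * zVar) ^ 2 * wordSum n k + qNu * zVar ^ 2 * wordSum n (k + 1)) := by
  refine (wordSum_eq_mul_sum (Nat.le_add_left 1 k) hk).trans ?_
  simp only [Fintype.sum_prod_type, Direction.sum_univ, stepWeight, nextLength,
    Nat.add_sub_cancel]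
  ring

section Lommel

variable {K : Type*} [Field K]

theorem qLommel_succ_succ (z p t : K) (m : ℕ) :
    qLommel z p t (m + 2) =
      (z + z⁻¹ * (1 - t * p ^ (m + 1))) * qLommel z p t (m + 1) - qLommel z p t m :=
  rfl

theorem qLommel_mul_succ_succ (z p t : K) (m : ℕ) :
    qLommel z p (t * p) (m + 2) =
      (z + z⁻¹ * (1 - t * p ^ (m + 2))) * qLommel z p (t * p) (m + 1) - qLommel z p (t * p) m := by
  rw [qLommel_succ_succ]
  ring

theorem qLommel_casoratian (z p t : K) (m : ℕ) :
    qLommel z p t (m + 2) * qLommel z p (t * p) m -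
      qLommel z p t (m + 1) * qLommel z p (t * p) (m + 1) = -1 := by
  induction m with
  | zero =>
    simp only [qLommel]
    ring
  | succ m ih =>
    rw [← ih, qLommel_mul_succ_succ z p t m, qLommel_succ_succ z p t (m + 1)]
    ring

theorem qLommel_ne_zero_of_qLommel_succ_eq_zero {z p t : K} {m : ℕ}
    (h : qLommel z p t (m + 1) = 0) : qLommel z p (t * p) m ≠ 0 := by
  intro h'
  cases m with
  | zero => exact one_ne_zero h'
  | succ m => simpa [h, h'] using qLommel_casoratian z p t m

section Recurrence

variable {z p t : K} {m : ℕ} {u : ℕ → K}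

theorem eq_qLommel_mul_sub_qLommel_mul
    (hu : ∀ k ≤ m, u (k + 2) = (z + z⁻¹ * (1 - t * p ^ k)) * u (k + 1) - u k) {k : ℕ}
    (hk : k ≤ m) : u (k + 2) = qLommel z p t (k + 1) * u 1 - qLommel z p (t * p) k * u 0 := by
  induction k using Nat.twoStepInduction with
  | zero =>
    rw [hu 0 hk]
    simp only [qLommel, pow_zero]
    ring
  | one =>
    rw [hu 1 hk, hu 0 m.zero_le]
    simp only [qLommel]
    ring
  | more k ih₁ ih₂ =>
    rw [hu (k + 2) hk, ih₁ (by omega), ih₂ (by omega), qLommel_mul_succ_succ,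
      qLommel_succ_succ z p t (k + 1)]
    ring

theorem qLommel_ne_zero_of_recurrence
    (hu : ∀ k ≤ m, u (k + 2) = (z + z⁻¹ * (1 - t * p ^ k)) * u (k + 1) - u k)
    (h₀ : u 0 ≠ 0) (hm : u (m + 2) = 0) : qLommel z p t (m + 1) ≠ 0 := by
  intro hzero
  have hsol := eq_qLommel_mul_sub_qLommel_mul hu le_rfl
  rw [hm, hzero, zero_mul, zero_sub, zero_eq_neg, mul_eq_zero, or_iff_left h₀] at hsol
  exact qLommel_ne_zero_of_qLommel_succ_eq_zero hzero hsol

theorem eq_mul_qLommel_div_of_recurrence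
    (hu : ∀ k ≤ m, u (k + 2) = (z + z⁻¹ * (1 - t * p ^ k)) * u (k + 1) - u k)
    (h₀ : u 0 ≠ 0) (hm : u (m + 2) = 0) :
    u 1 = u 0 * (qLommel z p (t * p) m / qLommel z p t (m + 1)) := by
  have hsol := eq_qLommel_mul_sub_qLommel_mul hu le_rfl
  rw [mul_div_assoc', eq_div_iff (qLommel_ne_zero_of_recurrence hu h₀ hm)]
  linear_combination hm - hsol

end Recurrence

/-- The scaling by `(-t z) ^ k` makes the coefficient of the last term equal to `-1`. -/
theorem div_pow_recurrence {z q t : K} (hz : z ≠ 0) (hq : q ≠ 0) (ht : t ≠ 0) {x : ℕ → K} {k : ℕ}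
    (hx : x (k + 1) = q ^ (k + 1) * (t * x (k + 1) + x (k + 2) + (t * z) ^ 2 * x k +
      t * z ^ 2 * x (k + 1))) :
    x (k + 2) / (-(t * z)) ^ (k + 2) =
      (z + z⁻¹ * (1 - t⁻¹ * q⁻¹ ^ 1 * q⁻¹ ^ k)) * (x (k + 1) / (-(t * z)) ^ (k + 1)) -
        x k / (-(t * z)) ^ k := by
  have hsolve : x (k + 2) = (q⁻¹ ^ (k + 1) - t - t * z ^ 2) * x (k + 1) - (t * z) ^ 2 * x k := by
    have hinv : q⁻¹ ^ (k + 1) * q ^ (k + 1) = 1 := by rw [← mul_pow, inv_mul_cancel₀ hq, one_pow]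
    linear_combination -q⁻¹ ^ (k + 1) * hx - hinv * (t * x (k + 1) + x (k + 2) + (t * z) ^ 2 * x k +
      t * z ^ 2 * x (k + 1))
  rw [hsolve, mul_assoc t⁻¹, ← pow_add, add_comm 1 k, pow_add _ k 2, pow_succ (-(t * z)) k]
  have hpow : (-(t * z)) ^ k ≠ 0 := pow_ne_zero k (neg_ne_zero.2 (mul_ne_zero ht hz))
  generalize (-(t * z)) ^ k = c at hpow ⊢
  generalize q⁻¹ ^ (k + 1) = r
  field_simp
  ring

theorem qLommel_inv_ne_zero_and_eq_div_of_recurrence {z q t : K} (hz : z ≠ 0) (hq : q ≠ 0)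
    (ht : t ≠ 0) {m : ℕ} {x : ℕ → K}
    (hx : ∀ k ≤ m, x (k + 1) = q ^ (k + 1) * (t * x (k + 1) + x (k + 2) + (t * z) ^ 2 * x k +
      t * z ^ 2 * x (k + 1)))
    (h₀ : x 0 = 1) (hm : x (m + 2) = 0) :
    qLommel z q⁻¹ (t⁻¹ * q⁻¹ ^ 1) (m + 1) ≠ 0 ∧
      x 1 = -(t * z) *
        (qLommel z q⁻¹ (t⁻¹ * q⁻¹ ^ 2) m / qLommel z q⁻¹ (t⁻¹ * q⁻¹ ^ 1) (m + 1)) := by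
  let u (k : ℕ) : K := x k / (-(t * z)) ^ k
  have hu (k : ℕ) (hk : k ≤ m) := div_pow_recurrence hz hq ht (hx k hk)
  have hu₀ : u 0 = 1 := by simp only [u, h₀, pow_zero, div_one]
  have hu₁ : x 1 = -(t * z) * u 1 := by
    simp only [u, pow_one, mul_div_cancel₀ _ (neg_ne_zero.2 (mul_ne_zero ht hz))]
  have hum : u (m + 2) = 0 := by simp only [u, hm, zero_div]
  refine ⟨qLommel_ne_zero_of_recurrence hu (hu₀ ▸ one_ne_zero) hum, ?_⟩
  rw [hu₁, eq_mul_qLommel_div_of_recurrence hu (hu₀ ▸ one_ne_zero) hum, hu₀, one_mul,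
    mul_assoc t⁻¹, ← pow_succ]

end Lommel

theorem algebraMap_X_ne_zero (i : Fin 3) :
    algebraMap PSeries PField (MvPowerSeries.X i) ≠ 0 := by
  rw [Ne, FaithfulSMul.algebraMap_eq_zero_iff]
  intro h
  simpa [MvPowerSeries.coeff_X] using congrArg (MvPowerSeries.coeff (Finsupp.single i 1)) h

theorem mainTheorem2 (m : ℕ) :
    Summable (fun α : BoundedSkewShape (m + 1) => shapeWeight α.1) ∧
    lommelR (m + 1) 1 ≠ 0 ∧
    algebraMap PSeries PField (∑' α : BoundedSkewShape (m + 1), shapeWeight α.1) =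
      -(algebraMap PSeries PField qNu * algebraMap PSeries PField zVar) *
        (lommelR m 2 / lommelR (m + 1) 1) := by
  let x (k : ℕ) : PField := algebraMap PSeries PField (wordSum (m + 1) k)
  have hx (k : ℕ) (hk : k ≤ m) := congrArg (algebraMap PSeries PField)
    (wordSum_succ (Nat.succ_le_succ hk))
  simp only [map_add, map_mul, map_pow] at hx
  have h₀ : x 0 = 1 := by simp only [x, wordSum_zero, map_one]
  have hm : x (m + 2) = 0 := by
    simp only [x, wordSum_eq_zero (Nat.lt_succ_self (m + 1)), map_zero]
  have hsum := hasSum_shapeWeight (m + 1)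
  rw [hsum.tsum_eq]
  exact ⟨hsum.summable, qLommel_inv_ne_zero_and_eq_div_of_recurrence (algebraMap_X_ne_zero 0)
    (algebraMap_X_ne_zero 1) (algebraMap_X_ne_zero 2) (x := x) hx h₀ hm⟩
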